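/- **Setting.** Let $n\ge 0$. Traders and goods are numbered $1,\dots,n$, trader $k$ initially owning good $k$, and trader $k$ ranks all goods by a permutation $p_k=p_{k1}p_{k2}\dots p_{kn}$ of $\{1,\dots,n\}$, most preferred first. An allocation is a permutation $g_1\dots g_n$ of the goods (trader $k$ gets $g_k$). It is *stable* if, for every nonempty set $C$ of traders and every bijection $h\colon C\to C$ such that no $k\in C$ ranks $h_k$ below $g_k$, one has $h_k=g_k$ for all $k\in C$. For a permutation $\pi$ of $\{1,\dots,n\}$, *uniform hashing with priorities $\pi$* gives the (locally optimal) allocation $g$ in which, for $k=1,\dots,n$, $g_{\pi(k)}$ is the first item of $p_{\pi(k)}$ not in $\{g_{\pi(1)},\dots,g_{\pi(k-1)}\}$. The permutation $\pi$ is *consistent* with a permutation (shuffling) $\sigma$ if the preferences $p'$ defined by $p'_{\sigma(k)}=p_k$ have a unique stable allocation $g'$ and it satisfies $g'_{\sigma(k)}=g_k$ for all $k$, where $g$ is obtained from $p$ by uniform hashing with priorities $\pi$. **Lemma.** For every sequence $p=p_1\dots p_n$ of preference lists there is a bijection $\pi\mapsto\sigma$ from the permutations of $\{1,\dots,n\}$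 onto themselves such that $\pi$ is consistent with $\sigma$ whenever $\pi$ corresponds to $\sigma$. Moreover, the following forward construction, applied to any $\pi$, terminates with exactly the corresponding $\sigma$, and the following inverse construction, applied to any $\sigma$, terminates with exactly the corresponding $\pi$. In both constructions write the lists in rows $1,\dots,n$, circle one item $g_k$ in each row $k$ (list $p_k$), and delete all items to the right of the circled ones. Start with $m=0$, $X=\emptyset$, and $Y$ the set of rows whose first item is circled. To *renew* means to replace $X$ by $Y$ and then $Y$ by the set of rows whose first remaining item is now circled. *Forward construction.* Here $g$ is obtained by uniform hashing with priorities $\pi$. While $m<n$, let $k$ be minimal with $m<k\le n$ such that $k=n$, or $\pi(k+1)\in Y\setminus X$ and $\pi(k+1)>\pi(m+1)$, or $\pi(k+1)\notin Y$. Put $\sigma(\pi(j))=g_{\pi(j+1)}$ for $m<j<k$ and $\sigma(\pi(k))=g_{\pi(m+1)}$. If $k=n$, stop. Otherwise delete $g_{\pi(m+1)},\dots,g_{\pi(k)}$ from all rows where they are not circled; if $\pi(k+1)\notin Y$, renew; then put $m=k$ and continue. *Inverse construction.* Here $g_k=g'_{\sigma(k)}$, where $g'$ is the stable allocation of the shuffled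 preferences $p'_{\sigma(k)}=p_k$. While $m<n$, consider all cycles $(a_1,\dots,a_t)$, $t\ge1$, of distinct elements of $Y\setminus\{\pi(1),\dots,\pi(m)\}$ with $g_{a_{j+1}}=\sigma(a_j)$ for $1\le j<t$ and $g_{a_1}=\sigma(a_t)$. If there is none, renew. Otherwise call the largest element of a cycle not in $X$ its *leader* (each cycle has one), take the cycle with the smallest leader, numbered so that $a_1$ is its leader, put $\pi(m+1)=a_1,\dots,\pi(m+t)=a_t$, delete $\sigma(a_1),\dots,\sigma(a_t)$ from all rows where they are not circled, and increase $m$ by $t$. -/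

import Mathlib

/-- A sequence of preference lists for traders (and goods) `Fin n`:
`p k r` is the `r`-th choice of trader `k` (counting from `0`). -/
abbrev Prefs (n : ℕ) := Fin n → Equiv.Perm (Fin n)

/-- Trader `k` likes good `i` at least as much as good `j`: `i` is `j` or precedes `j` in list `p k`. -/
def Prefs.WeaklyPrefers {n : ℕ} (p : Prefs n) (k i j : Fin n) : Prop :=
  (p k).symm i ≤ (p k).symm j

/-- `g` is an allocation (trader `k` gets good `g k`) that is stable: if the members of a nonempty
coalition `C` redistribute their own goods among themselves by `h` so that nobody in `C` is worse
off than under `g`, then `h` agrees with `g` on `C`. -/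
def IsStable {n : ℕ} (p : Prefs n) (g : Fin n → Fin n) : Prop :=
  Function.Bijective g ∧
    ∀ C : Finset (Fin n), C.Nonempty → ∀ h : Fin n → Fin n, Set.BijOn h C C →
      (∀ k ∈ C, p.WeaklyPrefers k (h k) (g k)) → ∀ k ∈ C, h k = g k

/-- The first item of the list `l` that is not in `T`. -/
def firstFree {n : ℕ} (l : Equiv.Perm (Fin n)) (T : Finset (Fin n)) (hT : T.card < n) : Fin n :=
  l ((Finset.univ.filter fun r => l r ∉ T).min' (by
    obtain ⟨x, hx⟩ : ∃ x, x ∉ T := by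
      by_contra hcon
      push Not at hcon
      have := Finset.card_le_card (fun x _ => hcon x : (Finset.univ : Finset (Fin n)) ⊆ T)
      simp at this
      omega
    exact ⟨l.symm x, by simpa using hx⟩))

/-- The good obtained by the `k`-th trader in order of priority, `π k`, in uniform hashing:
the first item of the list of `π k` not already given to `π j` for some `j < k`. -/
def hashItem {n : ℕ} (p : Prefs n) (π : Equiv.Perm (Fin n)) (k : Fin n) : Fin n :=
  firstFree (p (π k)) ((Finset.Iio k).attach.image fun j => hashItem p π j.1)
    (lt_of_le_of_lt Finset.card_image_le (by simp))
termination_by (k : ℕ)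
decreasing_by exact Fin.lt_def.mp (Finset.mem_Iio.mp j.2)

/-- The allocation produced by uniform hashing with priorities `π`:
trader `i` gets the good `hashAlloc p π i`. -/
def hashAlloc {n : ℕ} (p : Prefs n) (π : Equiv.Perm (Fin n)) (i : Fin n) : Fin n :=
  hashItem p π (π.symm i)

/-- The shuffled preferences `p'`, with `p' (σ k) = p k`. -/
def Prefs.shuffle {n : ℕ} (p : Prefs n) (σ : Equiv.Perm (Fin n)) : Prefs n :=
  fun i => p (σ.symm i)

/-- `π` is consistent with `σ`: the shuffled preferences `p'` have exactly one stable allocation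
`g'`, namely `g' (σ k) = g k`, where `g` is produced by uniform hashing with priorities `π`. -/
def Consistent {n : ℕ} (p : Prefs n) (π σ : Equiv.Perm (Fin n)) : Prop :=
  ∀ g' : Fin n → Fin n, IsStable (p.shuffle σ) g' ↔ ∀ k, g' (σ k) = hashAlloc p π k

/-- Write the preference lists in rows, with `g i` circled in row `i`, delete everything to the
right of the circled items, and delete the goods in `R` wherever they are not circled. This is the
set of rows that then begin with (equivalently, consist only of) their circled item. -/
def circledFirst {n : ℕ} (p : Prefs n) (g : Fin n → Fin n) (R : Finset (Fin n)) :
    Finset (Fin n) :=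
  Finset.univ.filter fun i => ∀ r, r < (p i).symm (g i) → p i r ∈ R

/-- Positions are counted from `0`. With the positions `< m` of `π` already treated and current sets
`X`, `Y`, the next cycle may end just before position `k`. -/
def CycleBreak {n : ℕ} (π : Equiv.Perm (Fin n)) (X Y : Finset (Fin n)) (m : Fin n) (k : ℕ) : Prop :=
  k = n ∨ ∃ hk : k < n,
    (π ⟨k, hk⟩ ∈ Y \ X ∧ π m < π ⟨k, hk⟩) ∨ π ⟨k, hk⟩ ∉ Y

/-- `k` is the least number with `m < k ≤ n` at which a cycle break occurs. -/
def IsCycleEnd {n : ℕ} (π : Equiv.Perm (Fin n)) (X Y : Finset (Fin n)) (m : Fin n) (k : ℕ) : Prop :=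
  IsLeast {k' : ℕ | (m : ℕ) < k' ∧ k' ≤ n ∧ CycleBreak π X Y m k'} k

/-- Extend the partial map `s` by `π j ↦ g (π (j + 1))` for `m ≤ j < k - 1` and
`π (k - 1) ↦ g (π m)`. -/
def addCycle {n : ℕ} (π : Equiv.Perm (Fin n)) (g : Fin n → Fin n) (m : Fin n) (k : ℕ)
    (s : Fin n → Option (Fin n)) : Fin n → Option (Fin n) := fun i =>
  if m ≤ π.symm i ∧ ((π.symm i : Fin n) : ℕ) < k then
    if h : ((π.symm i : Fin n) : ℕ) + 1 < k ∧ ((π.symm i : Fin n) : ℕ) + 1 < n then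
      some (g (π ⟨(π.symm i : Fin n) + 1, h.2⟩))
    else some (g (π m))
  else s i

/-- The states `(m, X, Y, s)` reached by the forward construction on `π`, where `s` is the part of
the shuffling defined so far and `g` is the allocation found by uniform hashing. -/
inductive ForwardState {n : ℕ} (p : Prefs n) (π : Equiv.Perm (Fin n)) :
    ℕ → Finset (Fin n) → Finset (Fin n) → (Fin n → Option (Fin n)) → Prop
  | start :
      ForwardState p π 0 ∅ (circledFirst p (hashAlloc p π) ∅) (fun _ => none)
  /-- The last cycle. -/
  | finish (m : Fin n) (X Y : Finset (Fin n)) (s : Fin n → Option (Fin n)) :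
      ForwardState p π m X Y s → IsCycleEnd π X Y m n →
      ForwardState p π n X Y (addCycle π (hashAlloc p π) m n s)
  /-- A cycle after which `X` and `Y` stay the same. -/
  | keep (m k : Fin n) (X Y : Finset (Fin n)) (s : Fin n → Option (Fin n)) :
      ForwardState p π m X Y s → IsCycleEnd π X Y m k → π k ∈ Y →
      ForwardState p π k X Y (addCycle π (hashAlloc p π) m k s)
  /-- A cycle after which `X` and `Y` are renewed. -/
  | renew (m k : Fin n) (X Y : Finset (Fin n)) (s : Fin n → Option (Fin n)) :
      ForwardState p π m X Y s → IsCycleEnd π X Y m k → π k ∉ Y →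
      ForwardState p π k Y
        (circledFirst p (hashAlloc p π) ((Finset.Iio k).image fun j => hashAlloc p π (π j)))
        (addCycle π (hashAlloc p π) m k s)

/-- The forward construction, applied to `π`, terminates with the shuffling `σ`. -/
def ForwardConstruction {n : ℕ} (p : Prefs n) (π σ : Equiv.Perm (Fin n)) : Prop :=
  ∃ X Y, ForwardState p π n X Y (fun i => some (σ i))

/-- The rows `c = [a₁, …, a_t]`, all of them in `A`, form a cycle
`σ a₁ ← σ a₂ ← ⋯ ← σ a_t ← σ a₁`, where `σ a ← σ b` means that the item circled in the list of
trader `σ b` is `σ a`. Here `g b` is the item circled in the list of trader `σ b`. -/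
def IsCycleIn {n : ℕ} (g : Fin n → Fin n) (σ : Equiv.Perm (Fin n)) (A : Finset (Fin n))
    (c : List (Fin n)) : Prop :=
  c ≠ [] ∧ c.Nodup ∧ (∀ a ∈ c, a ∈ A) ∧
    ∀ (j : ℕ) (hj : j < c.length),
      g (c.get ⟨(j + 1) % c.length, Nat.mod_lt _ (Nat.zero_lt_of_lt hj)⟩) = σ (c.get ⟨j, hj⟩)

/-- `a :: c` is a cycle of rows in `A`, numbered so that it starts with its leader `a`,
the largest of its elements that are not in `X`. -/
def IsLedCycleIn {n : ℕ} (g : Fin n → Fin n) (σ : Equiv.Perm (Fin n)) (X A : Finset (Fin n))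
    (a : Fin n) (c : List (Fin n)) : Prop :=
  IsCycleIn g σ A (a :: c) ∧ a ∉ X ∧ ∀ b ∈ c, b ∉ X → b ≤ a

/-- The states `(L, X, Y)` reached by the inverse construction on `σ`, where `L` lists the values
`π 0, …, π (m - 1)` defined so far and `g k` is the item circled in the list of trader `σ k`. -/
inductive InverseState {n : ℕ} (p : Prefs n) (g : Fin n → Fin n) (σ : Equiv.Perm (Fin n)) :
    List (Fin n) → Finset (Fin n) → Finset (Fin n) → Prop
  | start : InverseState p g σ [] ∅ (circledFirst p g ∅)
  /-- Record the cycle whose leader is smallest. -/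
  | record (L : List (Fin n)) (X Y : Finset (Fin n)) (a : Fin n) (c : List (Fin n)) :
      InverseState p g σ L X Y →
      IsLedCycleIn g σ X (Y \ L.toFinset) a c →
      (∀ a' c', IsLedCycleIn g σ X (Y \ L.toFinset) a' c' → a ≤ a') →
      InverseState p g σ (L ++ a :: c) X Y
  /-- When all the cycles have been recorded, but not yet all the rows, renew `X` and `Y`. -/
  | renew (L : List (Fin n)) (X Y : Finset (Fin n)) :
      InverseState p g σ L X Y → L.length < n →
      (∀ c, ¬ IsCycleIn g σ (Y \ L.toFinset) c) →
      InverseState p g σ L Y (circledFirst p g (L.toFinset.image σ))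

/-- The inverse construction, applied to `σ` (circling the stable allocation `g'` of the shuffled
preferences), terminates with the priority permutation `π`. -/
def InverseConstruction {n : ℕ} (p : Prefs n) (σ π : Equiv.Perm (Fin n)) : Prop :=
  ∃ g', IsStable (p.shuffle σ) g' ∧
    ∃ X Y, InverseState p (fun k => g' (σ k)) σ (List.ofFn π) X Y

/-! The cycle breaks cut the priority order `π` into consecutive blocks, and `σ` (`shuffling`) sends
each row to the good circled in the cyclically next row of its block. So the traders `σ k`, for `k`
in a block, own exactly the goods circled in that block. Every row lies in `Y` when it is treated,
so whatever it prefers to its circled good was circled in an earlier block. Ranking by blocks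
therefore makes the allocation the unique stable one (`isStable_iff_of_rank`,
`consistent_shuffling`).

For bijectivity, it suffices that the inverse construction recovers `π` from `σ`. The first row of a
block is its leader, leaders increase while `X` and `Y` stay fixed, and blocks treated after a
renewal start outside the old `Y`. Hence the unrecorded cycle with the smallest leader is always the
next block (`inverseState_succ`). The inverse construction is deterministic
(`InverseState.ofFn_unique`), so `shuffling` is injective on a finite set. That the forward
construction yields `shuffling`, and nothing else, is `forwardConstruction_iff`. -/

theorem firstFree_notMem {n : ℕ} (l : Equiv.Perm (Fin n)) (T : Finset (Fin n)) (hT : T.card < n) :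
    firstFree l T hT ∉ T :=
  (Finset.mem_filter.1 (Finset.min'_mem (Finset.univ.filter fun r => l r ∉ T) _)).2

theorem mem_of_lt_firstFree {n : ℕ} {l : Equiv.Perm (Fin n)} {T : Finset (Fin n)} {hT : T.card < n}
    {r : Fin n} (hr : r < l.symm (firstFree l T hT)) : l r ∈ T := by
  by_contra h
  have := Finset.min'_le (Finset.univ.filter fun r => l r ∉ T) r (by simpa using h)
  rw [firstFree, Equiv.symm_apply_apply] at hr
  exact absurd hr (not_lt.2 this)

theorem hashItem_ne {n : ℕ} (p : Prefs n) (π : Equiv.Perm (Fin n)) {j k : Fin n} (h : j < k) :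
    hashItem p π j ≠ hashItem p π k := by
  intro he
  conv_rhs at he => rw [hashItem]
  refine firstFree_notMem (p (π k)) _ _ (Eq.subst (motive := (· ∈ _)) he ?_)
  exact Finset.mem_image.2 ⟨⟨j, Finset.mem_Iio.2 h⟩, Finset.mem_attach _ _, rfl⟩

theorem hashItem_injective {n : ℕ} (p : Prefs n) (π : Equiv.Perm (Fin n)) :
    Function.Injective (hashItem p π) := by
  intro j k h
  rcases lt_trichotomy j k with hlt | rfl | hlt
  · exact absurd h (hashItem_ne p π hlt)
  · rfl
  · exact absurd h.symm (hashItem_ne p π hlt)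

theorem hashAlloc_injective {n : ℕ} (p : Prefs n) (π : Equiv.Perm (Fin n)) :
    Function.Injective (hashAlloc p π) :=
  (hashItem_injective p π).comp π.symm.injective

/-- Goods that a trader prefers to the one obtained were taken earlier. -/
theorem exists_lt_hashAlloc_eq {n : ℕ} (p : Prefs n) (π : Equiv.Perm (Fin n)) {k r : Fin n}
    (hr : r < (p (π k)).symm (hashAlloc p π (π k))) :
    ∃ j < k, hashAlloc p π (π j) = p (π k) r := by
  have hk : hashAlloc p π (π k) = hashItem p π k := by simp [hashAlloc]
  rw [hk, hashItem] at hr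
  obtain ⟨⟨j, hj⟩, -, h⟩ := Finset.mem_image.1 (mem_of_lt_firstFree hr)
  exact ⟨j, Finset.mem_Iio.1 hj, by simpa [hashAlloc] using h⟩

theorem mem_circledFirst {n : ℕ} {p : Prefs n} {g : Fin n → Fin n} {R : Finset (Fin n)}
    {i : Fin n} : i ∈ circledFirst p g R ↔ ∀ r, r < (p i).symm (g i) → p i r ∈ R := by
  simp [circledFirst]

theorem circledFirst_mono {n : ℕ} (p : Prefs n) (g : Fin n → Fin n) {R S : Finset (Fin n)}
    (h : R ⊆ S) : circledFirst p g R ⊆ circledFirst p g S := fun _ hi =>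
  mem_circledFirst.2 fun r hr => h (mem_circledFirst.1 hi r hr)

/-! ### A criterion for a unique stable allocation -/

/-- If traders can be ranked so that every trader gets a good of an equally ranked trader and
prefers only goods of lower ranked traders, then the allocation is the only stable one. -/
theorem isStable_iff_of_rank {n : ℕ} (P : Prefs n) {G : Fin n → Fin n} (hG : Function.Injective G)
    (f : Fin n → ℕ) (hf : ∀ t, f (G t) = f t)
    (hP : ∀ t i, (P t).symm i < (P t).symm (G t) → f i < f t) (G' : Fin n → Fin n) :
    IsStable P G' ↔ G' = G := by
  have hGb : Function.Bijective G := Finite.injective_iff_bijective.1 hG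
  constructor
  · rintro ⟨hb, hs⟩
    have key : ∀ r, ∀ t, f t = r → G' t = G t := by
      intro r
      induction r using Nat.strong_induction_on with
      | _ r ih =>
        intro t ht
        -- All traders of rank `r` form a coalition that redistributes by `G`. A member preferring
        -- `G' t` to `G t` would hold a good of lower rank, which by induction already belongs to a
        -- trader of lower rank.
        refine (hs (Finset.univ.filter fun t => f t = r) ⟨t, by simpa using ht⟩ G ?_ ?_ t
          (by simpa using ht)).symm
        · refine ⟨fun t ht => by simpa [hf] using ht, hG.injOn, fun y hy => ?_⟩
          obtain ⟨u, rfl⟩ := hGb.2 y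
          exact ⟨u, by simpa [hf] using hy, rfl⟩
        · intro t ht
          have ht : f t = r := by simpa using ht
          refine not_lt.1 fun hlt => ?_
          obtain ⟨u, hu⟩ := hGb.2 (G' t)
          by_cases h2 : f (G' t) < r
          · have h3 : f u < r := by rw [← hf, hu]; exact h2
            have h4 := hb.1 ((ih _ h3 u rfl).trans hu)
            rw [h4] at h3
            omega
          · exact h2 (ht ▸ hP t _ hlt)
    exact funext fun t => key _ t rfl
  · rintro rfl
    refine ⟨hGb, fun C _ h hC hw => ?_⟩
    have hle : ∀ k ∈ C, f (h k) ≤ f k := fun k hk => by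
      rcases (hw k hk).lt_or_eq with hlt | heq
      · exact (hP _ _ hlt).le
      · rw [(P k).symm.injective heq, hf]
    -- `h` permutes `C`, so the total rank is unchanged; one strict improvement would lower it.
    have hsum : ∑ k ∈ C, f (h k) = ∑ k ∈ C, f k :=
      Finset.sum_nbij h (fun k hk => hC.1 hk) hC.2.1 hC.2.2 fun _ _ => rfl
    have heq := (Finset.sum_eq_sum_iff_of_le hle).1 hsum
    intro k hk
    rcases (hw k hk).lt_or_eq with hlt | he
    · exact absurd (heq k hk) (hP _ _ hlt).ne
    · exact (P k).symm.injective he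

/-! ### Blocks of the priority order and the shuffling they define -/

section Phases

variable {n : ℕ} [NeZero n]

/-- The row with priority `j`. -/
def rowAt (π : Equiv.Perm (Fin n)) (j : ℕ) : Fin n := π (Fin.ofNat n j)

theorem rowAt_of_lt (π : Equiv.Perm (Fin n)) {j : ℕ} (hj : j < n) : rowAt π j = π ⟨j, hj⟩ := by
  rw [rowAt]; congr 1; ext; simp [Nat.mod_eq_of_lt hj]

theorem rowAt_val (π : Equiv.Perm (Fin n)) (i : Fin n) : rowAt π i = π i :=
  rowAt_of_lt π i.2

theorem rowAt_inj (π : Equiv.Perm (Fin n)) {j k : ℕ} (hj : j < n) (hk : k < n) :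
    rowAt π j = rowAt π k ↔ j = k := by
  simp [rowAt_of_lt π hj, rowAt_of_lt π hk]

theorem symm_rowAt (π : Equiv.Perm (Fin n)) {j : ℕ} (hj : j < n) :
    ((π.symm (rowAt π j) : Fin n) : ℕ) = j := by
  simp [rowAt_of_lt π hj]

theorem rowAt_symm (π : Equiv.Perm (Fin n)) (i : Fin n) : rowAt π (π.symm i : Fin n) = i := by
  simp [rowAt_val]

/-- The goods of the first `k` traders in order of priority. -/
def firstGoods (p : Prefs n) (π : Equiv.Perm (Fin n)) (k : ℕ) : Finset (Fin n) :=
  (Finset.range k).image fun j => hashAlloc p π (rowAt π j)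

theorem firstGoods_mono (p : Prefs n) (π : Equiv.Perm (Fin n)) {j k : ℕ} (h : j ≤ k) :
    firstGoods p π j ⊆ firstGoods p π k :=
  Finset.image_subset_image (by simpa using h)

theorem image_Iio_hashAlloc (p : Prefs n) (π : Equiv.Perm (Fin n)) (k : Fin n) :
    ((Finset.Iio k).image fun j => hashAlloc p π (π j)) = firstGoods p π k := by
  ext x
  simp only [firstGoods, Finset.mem_image, Finset.mem_Iio, Finset.mem_range]
  constructor
  · rintro ⟨j, hj, rfl⟩
    exact ⟨j, hj, by rw [rowAt_val]⟩
  · rintro ⟨j, hj, rfl⟩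
    exact ⟨⟨j, hj.trans k.2⟩, hj, by rw [rowAt_of_lt π (hj.trans k.2)]⟩

theorem rowAt_mem_circledFirst (p : Prefs n) (π : Equiv.Perm (Fin n)) {k : ℕ} (hk : k < n) :
    rowAt π k ∈ circledFirst p (hashAlloc p π) (firstGoods p π k) := by
  rw [mem_circledFirst, rowAt_of_lt π hk]
  intro r hr
  obtain ⟨j, hj, h⟩ := exists_lt_hashAlloc_eq p π hr
  exact Finset.mem_image.2 ⟨j, Finset.mem_range.2 hj, by rw [rowAt_val, h]⟩

/-- The first position of the cycle that contains position `j`, and the sets `X` and `Y` at the time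
when that cycle is treated. -/
def phase (p : Prefs n) (π : Equiv.Perm (Fin n)) : ℕ → ℕ × Finset (Fin n) × Finset (Fin n)
  | 0 => (0, ∅, circledFirst p (hashAlloc p π) ∅)
  | j + 1 =>
    if rowAt π (j + 1) ∉ (phase p π j).2.2 then
      (j + 1, (phase p π j).2.2, circledFirst p (hashAlloc p π) (firstGoods p π (j + 1)))
    else if rowAt π (j + 1) ∉ (phase p π j).2.1 ∧ rowAt π (phase p π j).1 < rowAt π (j + 1) then
      (j + 1, (phase p π j).2)
    else phase p π j

/-- The first position of the cycle that contains position `j`. -/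
abbrev blockStart (p : Prefs n) (π : Equiv.Perm (Fin n)) (j : ℕ) : ℕ := (phase p π j).1

/-- The set `X` when the cycle containing position `j` is treated. -/
abbrev oldRows (p : Prefs n) (π : Equiv.Perm (Fin n)) (j : ℕ) : Finset (Fin n) := (phase p π j).2.1

/-- The set `Y` when the cycle containing position `j` is treated. -/
abbrev curRows (p : Prefs n) (π : Equiv.Perm (Fin n)) (j : ℕ) : Finset (Fin n) := (phase p π j).2.2

variable (p : Prefs n) (π : Equiv.Perm (Fin n))

theorem phase_succ_renew {j : ℕ} (h : rowAt π (j + 1) ∉ curRows p π j) :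
    phase p π (j + 1) = (j + 1, curRows p π j,
      circledFirst p (hashAlloc p π) (firstGoods p π (j + 1))) := by
  rw [phase, if_pos h]

theorem phase_succ_keep {j : ℕ} (h : rowAt π (j + 1) ∈ curRows p π j)
    (h' : rowAt π (j + 1) ∉ oldRows p π j ∧ rowAt π (blockStart p π j) < rowAt π (j + 1)) :
    phase p π (j + 1) = (j + 1, oldRows p π j, curRows p π j) := by
  rw [phase, if_neg (not_not.2 h), if_pos h']

theorem phase_succ_same {j : ℕ} (h : rowAt π (j + 1) ∈ curRows p π j)
    (h' : ¬ (rowAt π (j + 1) ∉ oldRows p π j ∧ rowAt π (blockStart p π j) < rowAt π (j + 1))) :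
    phase p π (j + 1) = phase p π j := by
  rw [phase, if_neg (not_not.2 h), if_neg h']

theorem phase_succ_cases (j : ℕ) :
    (rowAt π (j + 1) ∉ curRows p π j ∧ phase p π (j + 1) = (j + 1, curRows p π j,
      circledFirst p (hashAlloc p π) (firstGoods p π (j + 1)))) ∨
    (rowAt π (j + 1) ∈ curRows p π j ∧
      (rowAt π (j + 1) ∉ oldRows p π j ∧ rowAt π (blockStart p π j) < rowAt π (j + 1)) ∧
      phase p π (j + 1) = (j + 1, oldRows p π j, curRows p π j)) ∨
    (rowAt π (j + 1) ∈ curRows p π j ∧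
      ¬ (rowAt π (j + 1) ∉ oldRows p π j ∧ rowAt π (blockStart p π j) < rowAt π (j + 1)) ∧
      phase p π (j + 1) = phase p π j) := by
  by_cases h : rowAt π (j + 1) ∈ curRows p π j
  · by_cases h' : rowAt π (j + 1) ∉ oldRows p π j ∧ rowAt π (blockStart p π j) < rowAt π (j + 1)
    · exact Or.inr (Or.inl ⟨h, h', phase_succ_keep p π h h'⟩)
    · exact Or.inr (Or.inr ⟨h, h', phase_succ_same p π h h'⟩)
  · exact Or.inl ⟨h, phase_succ_renew p π h⟩

theorem blockStart_succ (j : ℕ) :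
    blockStart p π (j + 1) = j + 1 ∨ phase p π (j + 1) = phase p π j := by
  rcases phase_succ_cases p π j with ⟨_, h⟩ | ⟨_, _, h⟩ | ⟨_, _, h⟩
  · exact Or.inl (by rw [blockStart, h])
  · exact Or.inl (by rw [blockStart, h])
  · exact Or.inr h

theorem blockStart_le (j : ℕ) : blockStart p π j ≤ j := by
  induction j with
  | zero => exact le_rfl
  | succ j ih =>
    rcases blockStart_succ p π j with h | h
    · exact h.le
    · rw [blockStart, h]; exact ih.trans (Nat.le_succ j)

theorem blockStart_mono : Monotone (blockStart p π) :=
  monotone_nat_of_le_succ fun j => by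
    rcases blockStart_succ p π j with h | h
    · rw [h]; exact (blockStart_le p π j).trans (Nat.le_succ j)
    · exact (congrArg Prod.fst h).ge

/-- `phase` changes only where a block starts. -/
theorem phase_eq_of_blockStart_le {j k : ℕ} (h : blockStart p π j ≤ k) (hk : k ≤ j) :
    phase p π k = phase p π j := by
  induction j with
  | zero => rw [Nat.le_zero.1 hk]
  | succ j ih =>
    rcases hk.eq_or_lt with rfl | hk
    · rfl
    rcases blockStart_succ p π j with hs | hs
    · omega
    · rw [hs]
      rw [blockStart, hs] at h
      exact ih h (Nat.lt_succ_iff.1 hk)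

theorem phase_blockStart (j : ℕ) : phase p π (blockStart p π j) = phase p π j :=
  phase_eq_of_blockStart_le p π le_rfl (blockStart_le p π j)

/-- Here `r` is the position of the last renewal, or `0`. Renewals occur only at block starts,
whence the bound on which consistency rests. -/
theorem exists_curRows_eq (j : ℕ) : ∃ r ≤ blockStart p π j,
    curRows p π j = circledFirst p (hashAlloc p π) (firstGoods p π r) := by
  induction j with
  | zero => exact ⟨0, le_rfl, rfl⟩
  | succ j ih =>
    obtain ⟨r, hr, h⟩ := ih
    rcases phase_succ_cases p π j with ⟨_, hs⟩ | ⟨_, _, hs⟩ | ⟨_, _, hs⟩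
    · exact ⟨j + 1, by rw [blockStart, hs], by rw [curRows, hs]⟩
    · exact ⟨r, by rw [blockStart, hs]; exact (hr.trans (blockStart_le p π j)).trans (Nat.le_succ j),
        by rw [curRows, hs]; exact h⟩
    · exact ⟨r, by rw [blockStart, hs]; exact hr, by rw [curRows, hs]; exact h⟩

theorem curRows_subset_succ (j : ℕ) : curRows p π j ⊆ curRows p π (j + 1) := by
  rcases phase_succ_cases p π j with ⟨_, hs⟩ | ⟨_, _, hs⟩ | ⟨_, _, hs⟩
  · obtain ⟨r, hr, h⟩ := exists_curRows_eq p π j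
    rw [h, curRows, hs]
    exact circledFirst_mono _ _ (firstGoods_mono p π
      ((hr.trans (blockStart_le p π j)).trans (Nat.le_succ j)))
  · rw [curRows, curRows, hs]
  · rw [curRows, curRows, hs]

theorem oldRows_subset_curRows (j : ℕ) : oldRows p π j ⊆ curRows p π j := by
  induction j with
  | zero => exact Finset.empty_subset _
  | succ j ih =>
    rcases phase_succ_cases p π j with ⟨_, hs⟩ | ⟨_, _, hs⟩ | ⟨_, _, hs⟩
    · have := curRows_subset_succ p π j
      rw [oldRows, hs]
      exact this
    · rw [oldRows, curRows, hs]; exact ih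
    · rw [oldRows, curRows, hs]; exact ih

/-- A row outside `Y` triggers a renewal, and by then all goods it prefers have been deleted. -/
theorem rowAt_mem_curRows {j : ℕ} (hj : j < n) : rowAt π j ∈ curRows p π j := by
  cases j with
  | zero =>
    have := rowAt_mem_circledFirst p π hj
    rwa [firstGoods, Finset.range_zero, Finset.image_empty] at this
  | succ j =>
    rcases phase_succ_cases p π j with ⟨_, hs⟩ | ⟨h, _, hs⟩ | ⟨h, _, hs⟩
    · rw [curRows, hs]; exact rowAt_mem_circledFirst p π hj
    · rw [curRows, hs]; exact h
    · rw [curRows, hs]; exact h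

/-- With `rowAt_le_blockStart`, this makes the first row of a block its leader. After a renewal the
new `X` is the old `Y`, which the triggering row missed. -/
theorem rowAt_blockStart_notMem (j : ℕ) : rowAt π (blockStart p π j) ∉ oldRows p π j := by
  induction j with
  | zero => exact Finset.notMem_empty _
  | succ j ih =>
    rcases phase_succ_cases p π j with ⟨h, hs⟩ | ⟨_, h, hs⟩ | ⟨_, _, hs⟩
    · rw [blockStart, oldRows, hs]; exact h
    · rw [blockStart, oldRows, hs]; exact h.1
    · rw [blockStart, oldRows, hs]; exact ih

theorem rowAt_le_blockStart {j : ℕ} (h : rowAt π j ∉ oldRows p π j) :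
    rowAt π j ≤ rowAt π (blockStart p π j) := by
  cases j with
  | zero => exact le_rfl
  | succ j =>
    rcases phase_succ_cases p π j with ⟨_, hs⟩ | ⟨_, _, hs⟩ | ⟨_, h', hs⟩
    · rw [blockStart, hs]
    · rw [blockStart, hs]
    · rw [oldRows, hs] at h
      rw [blockStart, hs]
      exact not_lt.1 fun hl => h' ⟨h, hl⟩

/-- Later cycles belong to the same phase and have larger leaders, or belong to a later phase. -/
theorem phase_le {j k : ℕ} (h : j ≤ k) :
    (oldRows p π k = oldRows p π j ∧ curRows p π k = curRows p π j ∧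
      rowAt π (blockStart p π j) ≤ rowAt π (blockStart p π k)) ∨
    curRows p π j ⊆ oldRows p π k := by
  induction k, h using Nat.le_induction with
  | base => exact Or.inl ⟨rfl, rfl, le_rfl⟩
  | succ k hk ih =>
    rcases phase_succ_cases p π k with ⟨_, hs⟩ | ⟨_, h, hs⟩ | ⟨_, _, hs⟩
    · refine Or.inr ?_
      rw [oldRows, hs]
      rcases ih with ih | ih
      · exact ih.2.1.ge
      · exact ih.trans (oldRows_subset_curRows p π k)
    · rw [oldRows, curRows, blockStart, blockStart, hs]
      exact ih.imp (fun ih => ⟨ih.1, ih.2.1, ih.2.2.trans h.2.le⟩) id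
    · rw [oldRows, curRows, blockStart, blockStart, hs]
      exact ih

/-- The position that follows `j` in its cycle. -/
def nextPos (j : ℕ) : ℕ :=
  -- The bound closes the last block: `phase` is defined beyond `n`, but carries no meaning there.
  if j + 1 < n ∧ blockStart p π (j + 1) = blockStart p π j then j + 1 else blockStart p π j

theorem nextPos_lt {j : ℕ} (hj : j < n) : nextPos p π j < n := by
  rw [nextPos]
  split_ifs with h
  · exact h.1
  · exact (blockStart_le p π j).trans_lt hj

theorem blockStart_nextPos (j : ℕ) : blockStart p π (nextPos p π j) = blockStart p π j := by
  rw [nextPos]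
  split_ifs with h
  · exact h.2
  · exact congrArg Prod.fst (phase_blockStart p π j)

/-- Equal successors force a common block. There the smaller position `j` is not last, so its
successor is `j + 1`, while that of the larger `k` is `k + 1` or the block start, which is at most
`j`. -/
theorem nextPos_injOn {j k : ℕ} (hj : j < n) (hk : k < n) (h : nextPos p π j = nextPos p π k) :
    j = k := by
  have hb : blockStart p π j = blockStart p π k := by
    rw [← blockStart_nextPos, h, blockStart_nextPos]
  have aux : ∀ {j k : ℕ}, k < n → j < k → blockStart p π j = blockStart p π k →
      nextPos p π j = j + 1 := fun {j k} hk hjk hb => by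
    have h1 := blockStart_mono p π (Nat.le_succ j)
    have h2 := blockStart_mono p π (Nat.succ_le_of_lt hjk)
    rw [nextPos, if_pos ⟨by omega, by simp only [Nat.succ_eq_add_one] at *; omega⟩]
  have hlt : ∀ {j k : ℕ}, k < n → j < k → blockStart p π j = blockStart p π k →
      nextPos p π j ≠ nextPos p π k := fun {j k} hk hjk hb he => by
    rw [aux hk hjk hb, nextPos] at he
    have := blockStart_le p π j
    split_ifs at he <;> omega
  rcases lt_trichotomy j k with hjk | rfl | hjk
  · exact absurd h (hlt hk hjk hb)
  · rfl
  · exact absurd h.symm (hlt hj hjk hb.symm)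

/-- The shuffling that corresponds to the priorities `π`, as a map. -/
def shufflingFun (i : Fin n) : Fin n :=
  hashAlloc p π (rowAt π (nextPos p π (π.symm i : Fin n)))

theorem shufflingFun_injective : Function.Injective (shufflingFun p π) := by
  intro i j h
  have h1 := (rowAt_inj π (nextPos_lt p π (π.symm i).2) (nextPos_lt p π (π.symm j).2)).1
    (hashAlloc_injective p π h)
  exact π.symm.injective (Fin.ext (nextPos_injOn p π (π.symm i).2 (π.symm j).2 h1))

/-- The shuffling that corresponds to the priorities `π`. -/
noncomputable def shuffling : Equiv.Perm (Fin n) :=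
  Equiv.ofBijective (shufflingFun p π)
    (Finite.injective_iff_bijective.1 (shufflingFun_injective p π))

theorem shuffling_rowAt {j : ℕ} (hj : j < n) :
    shuffling p π (rowAt π j) = hashAlloc p π (rowAt π (nextPos p π j)) := by
  rw [shuffling, Equiv.ofBijective_apply, shufflingFun, symm_rowAt π hj]

theorem consistent_shuffling : Consistent p π (shuffling p π) := by
  intro g'
  have hgb := Finite.injective_iff_bijective.1 (hashAlloc_injective p π)
  let g : Equiv.Perm (Fin n) := Equiv.ofBijective (hashAlloc p π) hgb
  have hg : ∀ i, g.symm (hashAlloc p π i) = i := fun i => g.symm_apply_apply i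
  set σ := shuffling p π with hσ
  have hform : ∀ t, ∃ j < n, t = σ (rowAt π j) := fun t =>
    ⟨π.symm (σ.symm t), Fin.is_lt _, by rw [rowAt_symm, Equiv.apply_symm_apply]⟩
  -- The block of the row in which good `x` is circled, named by its first position.
  let f : Fin n → ℕ := fun x => blockStart p π (π.symm (g.symm x) : Fin n)
  have hf : ∀ {j}, j < n → f (hashAlloc p π (rowAt π j)) = blockStart p π j := fun hj => by
    simp only [f]
    rw [hg, symm_rowAt π hj]
  have hfσ : ∀ {j}, j < n → f (σ (rowAt π j)) = blockStart p π j := fun hj => by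
    rw [hσ, shuffling_rowAt p π hj, hf (nextPos_lt p π hj), blockStart_nextPos]
  rw [isStable_iff_of_rank (p.shuffle σ) (G := fun t => hashAlloc p π (σ.symm t))
    ((hashAlloc_injective p π).comp σ.symm.injective) f]
  · constructor
    · rintro rfl k
      simp
    · intro h
      funext t
      simpa using h (σ.symm t)
  · intro t
    obtain ⟨j, hj, rfl⟩ := hform t
    rw [Equiv.symm_apply_apply, hf hj, hfσ hj]
  · intro t i hi
    obtain ⟨j, hj, rfl⟩ := hform t
    rw [Prefs.shuffle, Equiv.symm_apply_apply] at hi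
    obtain ⟨r, hr, hY⟩ := exists_curRows_eq p π j
    have hm := rowAt_mem_curRows p π hj
    rw [hY] at hm
    have := mem_circledFirst.1 hm _ hi
    rw [Equiv.apply_symm_apply] at this
    obtain ⟨l, hl, rfl⟩ := Finset.mem_image.1 this
    have hl := Finset.mem_range.1 hl
    have := blockStart_le p π j
    have := blockStart_le p π l
    rw [hf (by omega), hfσ hj]
    omega

end Phases

/-! ### The forward construction computes the shuffling -/

section Forward

variable {n : ℕ} [NeZero n] (p : Prefs n) (π : Equiv.Perm (Fin n))

/-- The shuffling, restricted to the rows whose position is less than `m`. -/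
noncomputable def partialShuffling (m : ℕ) (i : Fin n) : Option (Fin n) :=
  if (π.symm i : ℕ) < m then some (shuffling p π i) else none

/-- `hend` says that `j` is the last position of its block; it is vacuous for `j = n - 1`, so the
final cycle is covered too. -/
theorem addCycle_partialShuffling {j : ℕ} (hj : j < n)
    (hend : j + 1 < n → blockStart p π (j + 1) = j + 1) (m : Fin n) (hm : m = blockStart p π j) :
    addCycle π (hashAlloc p π) m (j + 1) (partialShuffling p π m) =
      partialShuffling p π (j + 1) := by
  have hmj : (m : ℕ) ≤ j := hm ▸ blockStart_le p π j
  have hπm : π m = rowAt π (blockStart p π j) := by rw [← hm, rowAt_val]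
  funext i
  set l : Fin n := π.symm i with hl
  have hi : i = rowAt π l := by rw [hl, rowAt_symm]
  have hσ : shuffling p π i = hashAlloc p π (rowAt π (nextPos p π l)) := by
    rw [hi, shuffling_rowAt p π l.2]
  simp only [addCycle, partialShuffling, ← hl, Fin.le_def]
  by_cases h1 : (l : ℕ) < m
  · rw [if_neg (by omega), if_pos h1, if_pos (by omega)]
  by_cases h2 : (l : ℕ) < j + 1
  · rw [if_pos (by omega), if_pos h2, hσ]
    have hb : blockStart p π l = blockStart p π j :=
      congrArg Prod.fst (phase_eq_of_blockStart_le p π (by omega) (by omega))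
    split_ifs with h3
    · have hb' : blockStart p π (l + 1) = blockStart p π j :=
        congrArg Prod.fst (phase_eq_of_blockStart_le p π (by omega) (by omega))
      rw [nextPos, if_pos ⟨h3.2, hb'.trans hb.symm⟩, rowAt_of_lt]
    · have hlj : (l : ℕ) = j := by omega
      rw [hlj, nextPos, if_neg, hπm]
      rintro ⟨h4, h5⟩
      have := hend h4
      omega
  · rw [if_neg (by omega), if_neg h1, if_neg h2]

theorem cycleBreak_succ_iff {j : ℕ} (hj : j + 1 < n) (m : Fin n) (hm : m = blockStart p π j) :
    CycleBreak π (oldRows p π j) (curRows p π j) m (j + 1) ↔ blockStart p π (j + 1) = j + 1 := by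
  have hπm : π m = rowAt π (blockStart p π j) := by rw [← hm, rowAt_val]
  have hle := blockStart_le p π j
  have hbr : CycleBreak π (oldRows p π j) (curRows p π j) m (j + 1) ↔
      (rowAt π (j + 1) ∈ curRows p π j \ oldRows p π j ∧
        rowAt π (blockStart p π j) < rowAt π (j + 1)) ∨ rowAt π (j + 1) ∉ curRows p π j := by
    rw [CycleBreak, rowAt_of_lt π hj, hπm]
    exact ⟨fun h => h.elim (fun h => absurd h hj.ne) fun ⟨_, h⟩ => h, fun h => Or.inr ⟨hj, h⟩⟩
  rw [hbr, Finset.mem_sdiff]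
  rcases phase_succ_cases p π j with ⟨h, hs⟩ | ⟨h, h', hs⟩ | ⟨h, h', hs⟩
  · exact iff_of_true (Or.inr h) (congrArg Prod.fst hs)
  · exact iff_of_true (Or.inl ⟨⟨h, h'.1⟩, h'.2⟩) (congrArg Prod.fst hs)
  · refine iff_of_false ?_ ?_
    · rintro (⟨⟨_, h1⟩, h2⟩ | h1)
      · exact h' ⟨h1, h2⟩
      · exact h1 h
    · have : blockStart p π (j + 1) = blockStart p π j := congrArg Prod.fst hs
      omega

theorem isCycleEnd_succ {j : ℕ} (hj : j < n)
    (hend : j + 1 < n → blockStart p π (j + 1) = j + 1) (m : Fin n) (hm : m = blockStart p π j) :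
    IsCycleEnd π (oldRows p π j) (curRows p π j) m (j + 1) := by
  have hmj : (m : ℕ) ≤ j := hm ▸ blockStart_le p π j
  refine ⟨⟨by omega, hj, ?_⟩, ?_⟩
  · rcases Nat.lt_or_ge (j + 1) n with h | h
    · exact (cycleBreak_succ_iff p π h m hm).2 (hend h)
    · exact Or.inl (by omega)
  · rintro k ⟨hmk, hkn, hk⟩
    by_contra hlt
    obtain ⟨k, rfl⟩ := Nat.exists_eq_succ_of_ne_zero (by omega : k ≠ 0)
    have h1 : phase p π k = phase p π j := phase_eq_of_blockStart_le p π (by omega) (by omega)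
    have h2 : blockStart p π (k + 1) = blockStart p π j :=
      congrArg Prod.fst (phase_eq_of_blockStart_le p π (by omega) (by omega))
    rw [oldRows, curRows, ← h1] at hk
    have := (cycleBreak_succ_iff p π (by omega) m (by rw [hm, blockStart, blockStart, h1])).1 hk
    omega

theorem phase_eq_of_isCycleEnd {m : Fin n} {X Y : Finset (Fin n)} {k : ℕ}
    (hm : phase p π m = (↑m, X, Y)) (hk : IsCycleEnd π X Y m k) {j : ℕ} (hmj : m ≤ j)
    (hjk : j < k) : phase p π j = (↑m, X, Y) := by
  induction j, hmj using Nat.le_induction with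
  | base => exact hm
  | succ j hmj ih =>
    have ih := ih (by omega)
    rcases blockStart_succ p π j with h | h
    · have hn : j + 1 < n := hjk.trans_le hk.1.2.1
      have := (cycleBreak_succ_iff p π hn m (by rw [blockStart, ih])).2 h
      rw [oldRows, curRows, ih] at this
      exact absurd (hk.2 ⟨by omega, hn.le, this⟩) (by omega)
    · rw [h, ih]

theorem forwardState_blockStart {j : ℕ} (hj : j < n) :
    ForwardState p π (blockStart p π j) (oldRows p π j) (curRows p π j)
      (partialShuffling p π (blockStart p π j)) := by
  induction j with
  | zero =>
    have : partialShuffling p π (blockStart p π 0) = fun _ => none :=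
      funext fun i => if_neg (Nat.not_lt_zero _)
    rw [this]
    exact ForwardState.start
  | succ j ih =>
    have ih := ih (by omega)
    have hlt := (blockStart_le p π j).trans_lt (Nat.lt_of_succ_lt hj)
    rcases phase_succ_cases p π j with ⟨h, hs⟩ | ⟨h, _, hs⟩ | ⟨_, _, hs⟩
    · have hb : blockStart p π (j + 1) = j + 1 := congrArg Prod.fst hs
      have := ForwardState.renew ⟨blockStart p π j, hlt⟩ ⟨j + 1, hj⟩ _ _ _ ih
        (isCycleEnd_succ p π (by omega) (fun _ => hb) _ rfl) (by rwa [← rowAt_of_lt])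
      rw [addCycle_partialShuffling p π (by omega) (fun _ => hb) ⟨blockStart p π j, hlt⟩ rfl,
        image_Iio_hashAlloc] at this
      rw [oldRows, curRows, blockStart, hs]
      exact this
    · have hb : blockStart p π (j + 1) = j + 1 := congrArg Prod.fst hs
      have := ForwardState.keep ⟨blockStart p π j, hlt⟩ ⟨j + 1, hj⟩ _ _ _ ih
        (isCycleEnd_succ p π (by omega) (fun _ => hb) _ rfl) (by rwa [← rowAt_of_lt])
      rw [addCycle_partialShuffling p π (by omega) (fun _ => hb) ⟨blockStart p π j, hlt⟩ rfl] at this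
      rw [oldRows, curRows, blockStart, hs]
      exact this
    · rw [oldRows, curRows, blockStart, hs]
      exact ih

theorem partialShuffling_self : partialShuffling p π n = fun i => some (shuffling p π i) :=
  funext fun i => if_pos (π.symm i).2

theorem exists_succ_eq_size (n : ℕ) [NeZero n] : ∃ j, j + 1 = n :=
  ⟨n - 1, Nat.sub_add_cancel (Nat.one_le_iff_ne_zero.2 (NeZero.ne n))⟩

theorem forwardConstruction_shuffling : ForwardConstruction p π (shuffling p π) := by
  obtain ⟨j, hjn⟩ := exists_succ_eq_size n
  have hj : j < n := by omega
  have hlt := (blockStart_le p π j).trans_lt hj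
  have hend : j + 1 < n → blockStart p π (j + 1) = j + 1 := fun h => absurd h (by omega)
  have h1 := isCycleEnd_succ p π hj hend ⟨_, hlt⟩ rfl
  have h2 := addCycle_partialShuffling p π hj hend ⟨_, hlt⟩ rfl
  rw [hjn] at h1 h2
  have := ForwardState.finish ⟨_, hlt⟩ _ _ _ (forwardState_blockStart p π hj) h1
  rw [h2, partialShuffling_self] at this
  exact ⟨_, _, this⟩

/-- Uniqueness of the result: every reachable state is the one predicted by `phase`. The claim on
`X` and `Y` is limited to `m < n` because they are not updated after the last cycle. -/
theorem ForwardState.eq_phase {m : ℕ} {X Y : Finset (Fin n)} {s : Fin n → Option (Fin n)}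
    (h : ForwardState p π m X Y s) :
    (m < n → phase p π m = (m, X, Y)) ∧ s = partialShuffling p π m := by
  have cyc : ∀ (m : Fin n) (X Y : Finset (Fin n)) (k : ℕ), phase p π m = (↑m, X, Y) →
      IsCycleEnd π X Y m k → ∃ j, k = j + 1 ∧ j < n ∧ phase p π j = (↑m, X, Y) ∧
        (j + 1 < n → blockStart p π (j + 1) = j + 1) := fun m X Y k hm hk => by
    have hmk := hk.1.1
    obtain ⟨j, rfl⟩ := Nat.exists_eq_succ_of_ne_zero (by omega : k ≠ 0)
    have hj := phase_eq_of_isCycleEnd p π hm hk (Nat.lt_succ_iff.1 hmk) (Nat.lt_succ_self j)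
    refine ⟨j, rfl, hk.1.2.1, hj, fun hn => ?_⟩
    refine (cycleBreak_succ_iff p π hn m (by rw [blockStart, hj])).1 ?_
    rw [oldRows, curRows, hj]
    exact hk.1.2.2
  induction h with
  | start =>
    exact ⟨fun _ => rfl, funext fun i => (if_neg (Nat.not_lt_zero _)).symm⟩
  | finish m X Y s _ hk ih =>
    obtain ⟨j, hjn, hj, hph, hend⟩ := cyc m X Y n (ih.1 m.2) hk
    refine ⟨fun h => absurd h (lt_irrefl _), ?_⟩
    have := addCycle_partialShuffling p π hj hend m (by rw [blockStart, hph])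
    rwa [← hjn, ← ih.2] at this
  | keep m k X Y s _ hk hkY ih =>
    obtain ⟨j, hjk, hj, hph, hend⟩ := cyc m X Y k (ih.1 m.2) hk
    have := addCycle_partialShuffling p π hj hend m (by rw [blockStart, hph])
    rw [← hjk, ← ih.2] at this
    refine ⟨fun hkn => ?_, this⟩
    have hb := hend (hjk ▸ hkn)
    rw [← rowAt_val, hjk] at hkY
    rw [hjk]
    have := blockStart_le p π j
    rcases phase_succ_cases p π j with ⟨h, hs⟩ | ⟨h, _, hs⟩ | ⟨_, _, hs⟩
    · rw [curRows, hph] at h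
      exact absurd hkY h
    · rw [hs, oldRows, curRows, hph]
    · have : blockStart p π (j + 1) = blockStart p π j := congrArg Prod.fst hs
      omega
  | renew m k X Y s _ hk hkY ih =>
    obtain ⟨j, hjk, hj, hph, hend⟩ := cyc m X Y k (ih.1 m.2) hk
    have := addCycle_partialShuffling p π hj hend m (by rw [blockStart, hph])
    rw [← hjk, ← ih.2] at this
    refine ⟨fun hkn => ?_, this⟩
    rw [image_Iio_hashAlloc]
    rw [← rowAt_val, hjk] at hkY
    rw [hjk, phase_succ_renew p π (by rwa [curRows, hph]), curRows, hph]

theorem forwardConstruction_iff (σ : Equiv.Perm (Fin n)) :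
    ForwardConstruction p π σ ↔ shuffling p π = σ := by
  constructor
  · rintro ⟨X, Y, h⟩
    have := (ForwardState.eq_phase p π h).2
    rw [partialShuffling_self] at this
    exact Equiv.ext fun i => Option.some_injective _ (congrFun this i).symm
  · rintro rfl
    exact forwardConstruction_shuffling p π

end Forward

/-! ### The inverse construction recovers the priorities -/

section Inverse

/-- One step of the inverse construction. -/
inductive InverseStep {n : ℕ} (p : Prefs n) (g : Fin n → Fin n) (σ : Equiv.Perm (Fin n)) :
    List (Fin n) × Finset (Fin n) × Finset (Fin n) →
      List (Fin n) × Finset (Fin n) × Finset (Fin n) → Prop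
  | record (L : List (Fin n)) (X Y : Finset (Fin n)) (a : Fin n) (c : List (Fin n)) :
      IsLedCycleIn g σ X (Y \ L.toFinset) a c →
      (∀ a' c', IsLedCycleIn g σ X (Y \ L.toFinset) a' c' → a ≤ a') →
      InverseStep p g σ (L, X, Y) (L ++ a :: c, X, Y)
  | renew (L : List (Fin n)) (X Y : Finset (Fin n)) :
      L.length < n → (∀ c, ¬ IsCycleIn g σ (Y \ L.toFinset) c) →
      InverseStep p g σ (L, X, Y) (L, Y, circledFirst p g (L.toFinset.image σ))

theorem InverseState.reflTransGen {n : ℕ} {p : Prefs n} {g : Fin n → Fin n}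
    {σ : Equiv.Perm (Fin n)} {L : List (Fin n)} {X Y : Finset (Fin n)}
    (h : InverseState p g σ L X Y) :
    Relation.ReflTransGen (InverseStep p g σ) ([], ∅, circledFirst p g ∅) (L, X, Y) := by
  induction h with
  | start => exact .refl
  | record L X Y a c _ h1 h2 ih => exact ih.tail (.record L X Y a c h1 h2)
  | renew L X Y _ h1 h2 ih => exact ih.tail (.renew L X Y h1 h2)

/-- A cycle is determined by its first element. -/
theorem IsCycleIn.tail_unique {n : ℕ} {g : Fin n → Fin n} (hg : Function.Injective g)
    {σ : Equiv.Perm (Fin n)} {A : Finset (Fin n)} {a : Fin n} {c c' : List (Fin n)}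
    (h : IsCycleIn g σ A (a :: c)) (h' : IsCycleIn g σ A (a :: c')) : c = c' := by
  have step : ∀ {d : List (Fin n)}, IsCycleIn g σ A (a :: d) → ∀ (j : ℕ)
      (hj : j + 1 < (a :: d).length), g ((a :: d)[j + 1]) = σ ((a :: d)[j]) := by
    intro d hd j hj
    have := hd.2.2.2 j (by omega)
    simpa only [List.get_eq_getElem, Nat.mod_eq_of_lt hj] using this
  have key : ∀ (j : ℕ) (hj : j < (a :: c).length) (hj' : j < (a :: c').length),
      (a :: c)[j] = (a :: c')[j] := by
    intro j
    induction j with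
    | zero => intros; rfl
    | succ j ih =>
      intro hj hj'
      apply hg
      rw [step h j hj, step h' j hj', ih]
  -- Where the shorter cycle closes up, the longer one would have to repeat its first element.
  have hlen : ∀ {d d' : List (Fin n)}, IsCycleIn g σ A (a :: d) → IsCycleIn g σ A (a :: d') →
      (∀ (j : ℕ) (hj : j < (a :: d).length) (hj' : j < (a :: d').length),
        (a :: d)[j] = (a :: d')[j]) → ¬ d.length < d'.length := by
    intro d d' hd hd' hk hlt
    have h1 := hd.2.2.2 d.length (by simp)
    have h2 := step hd' d.length (by simpa using hlt)
    simp only [List.get_eq_getElem, List.length_cons, Nat.mod_self] at h1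
    rw [← hk d.length (by simp) (Nat.lt_succ_of_lt hlt), ← h1] at h2
    have h3 := hg h2
    have h4 := (hd'.2.1.getElem_inj_iff (i := d.length + 1) (j := 0)
      (hi := by simpa using hlt) (hj := by simp)).1 h3
    omega
  have hl : c.length = c'.length := by
    have := hlen h h' key
    have := hlen h' h fun j hj hj' => (key j hj' hj).symm
    omega
  exact (List.cons_injective (List.ext_getElem (by simpa using hl) key))

/-- The smallest leader is unique and determines its cycle; renewal is allowed only when no cycle
exists. -/
theorem inverseStep_rightUnique {n : ℕ} (p : Prefs n) {g : Fin n → Fin n}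
    (hg : Function.Injective g) (σ : Equiv.Perm (Fin n)) :
    Relator.RightUnique (InverseStep p g σ) := by
  rintro S T T' h h'
  cases h with
  | record L X Y a c h1 h2 =>
    cases h' with
    | record _ _ _ a' c' h1' h2' =>
      obtain rfl : a = a' := le_antisymm (h2 _ _ h1') (h2' _ _ h1)
      rw [IsCycleIn.tail_unique hg h1.1 h1'.1]
    | renew _ _ _ _ h2' => exact absurd h1.1 (h2' _)
  | renew L X Y h1 h2 =>
    cases h' with
    | record _ _ _ a' c' h1' h2' => exact absurd h1'.1 (h2 _)
    | renew _ _ _ _ h2' => rfl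

theorem not_inverseStep_ofFn {n : ℕ} {p : Prefs n} {g : Fin n → Fin n} {σ π : Equiv.Perm (Fin n)}
    {X Y : Finset (Fin n)} {S : List (Fin n) × Finset (Fin n) × Finset (Fin n)} :
    ¬ InverseStep p g σ (List.ofFn π, X, Y) S := by
  intro h
  cases h with
  | record _ _ _ a c h1 h2 =>
    have h3 := h1.1.2.2.1 a (by simp)
    simp only [Finset.mem_sdiff, List.mem_toFinset, List.mem_ofFn] at h3
    exact h3.2 (π.surjective a)
  | renew _ _ _ h1 _ => simp at h1

/-- Two runs of a deterministic process from one start are comparable, and a complete list admits no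
further step. -/
theorem InverseState.ofFn_unique {n : ℕ} {p : Prefs n} {g : Fin n → Fin n}
    (hg : Function.Injective g) {σ π π' : Equiv.Perm (Fin n)} {X Y X' Y' : Finset (Fin n)}
    (h : InverseState p g σ (List.ofFn π) X Y) (h' : InverseState p g σ (List.ofFn π') X' Y') :
    π = π' := by
  have key : List.ofFn π = List.ofFn π' := by
    rcases Relation.ReflTransGen.total_of_right_unique (inverseStep_rightUnique p hg σ)
      h.reflTransGen h'.reflTransGen with h | h
    · rcases Relation.ReflTransGen.cases_head h with h | ⟨_, h, _⟩
      · exact congrArg Prod.fst h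
      · exact absurd h not_inverseStep_ofFn
    · rcases Relation.ReflTransGen.cases_head h with h | ⟨_, h, _⟩
      · exact (congrArg Prod.fst h).symm
      · exact absurd h not_inverseStep_ofFn
  exact DFunLike.coe_injective (List.ofFn_injective key)

variable {n : ℕ} [NeZero n] (p : Prefs n) (π : Equiv.Perm (Fin n))

/-- The first `k` rows in order of priority. -/
def firstRows (k : ℕ) : List (Fin n) := (List.range k).map (rowAt π)

theorem firstRows_self : firstRows π n = List.ofFn π := by
  refine List.ext_getElem (by simp [firstRows]) fun i h1 h2 => ?_
  have hi : i < n := by simpa using h2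
  simp [firstRows, rowAt_of_lt π hi]

theorem rowAt_mem_firstRows {j k : ℕ} (hj : j < n) (hk : k ≤ n) :
    rowAt π j ∈ firstRows π k ↔ j < k := by
  simp only [firstRows, List.mem_map, List.mem_range]
  constructor
  · rintro ⟨i, hi, h⟩
    rwa [← (rowAt_inj π (hi.trans_le hk) hj).1 h]
  · exact fun h => ⟨j, h, rfl⟩

/-- At a block start, the earlier rows form whole blocks, on each of which the shuffling permutes
the circled goods. So both constructions have deleted the same goods at a renewal. -/
theorem image_firstRows {k : ℕ} (hk : k < n) (hb : blockStart p π k = k) :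
    (firstRows π k).toFinset.image (shuffling p π) = firstGoods p π k := by
  have h1 : (firstRows π k).toFinset = (Finset.range k).image (rowAt π) := by
    ext; simp [firstRows]
  have h2 : firstGoods p π k = ((Finset.range k).image (rowAt π)).image (hashAlloc p π) :=
    (Finset.image_image (s := Finset.range k) (f := rowAt π) (g := hashAlloc p π)).symm
  rw [h1, h2]
  refine Finset.eq_of_subset_of_card_le ?_ ?_
  · intro x hx
    simp only [Finset.mem_image, Finset.mem_range] at hx ⊢
    obtain ⟨_, ⟨j, hj, rfl⟩, rfl⟩ := hx
    rw [shuffling_rowAt p π (hj.trans hk)]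
    refine ⟨_, ⟨nextPos p π j, ?_, rfl⟩, rfl⟩
    have := blockStart_le p π j
    rw [nextPos]
    split_ifs with h
    · refine lt_of_le_of_ne hj fun he => ?_
      rw [← he] at hb
      omega
    · omega
  · rw [Finset.card_image_of_injective _ (hashAlloc_injective p π),
      Finset.card_image_of_injective _ (shuffling p π).injective]

theorem IsCycleIn.rowAt_nextPos_mem {A : Finset (Fin n)} {c : List (Fin n)}
    (h : IsCycleIn (hashAlloc p π) (shuffling p π) A c) {j : ℕ} (hj : j < n)
    (hc : rowAt π j ∈ c) : rowAt π (nextPos p π j) ∈ c := by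
  obtain ⟨i, hi, he⟩ := List.getElem_of_mem hc
  have := h.2.2.2 i hi
  rw [List.get_eq_getElem, List.get_eq_getElem, he, shuffling_rowAt p π hj] at this
  rw [← hashAlloc_injective p π this]
  exact List.getElem_mem _

/-- A cycle is closed under `nextPos`, which runs to the end of the block and then returns to its
start. -/
theorem IsCycleIn.rowAt_blockStart_mem {A : Finset (Fin n)} {c : List (Fin n)}
    (h : IsCycleIn (hashAlloc p π) (shuffling p π) A c) {j : ℕ} (hj : j < n)
    (hc : rowAt π j ∈ c) : rowAt π (blockStart p π j) ∈ c := by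
  induction hd : n - j using Nat.strong_induction_on generalizing j with
  | _ d ih =>
    have h1 := h.rowAt_nextPos_mem p π hj hc
    by_cases hn : j + 1 < n ∧ blockStart p π (j + 1) = blockStart p π j
    · rw [nextPos, if_pos hn] at h1
      rw [← hn.2]
      exact ih (n - (j + 1)) (by omega) hn.1 h1 rfl
    · rwa [nextPos, if_neg hn] at h1

/-- A cycle of rows none of which is among the first `k` contains the first row of a later block. -/
theorem IsCycleIn.exists_blockStart {Y : Finset (Fin n)} {c : List (Fin n)} {k : ℕ} (hk : k ≤ n)
    (h : IsCycleIn (hashAlloc p π) (shuffling p π) (Y \ (firstRows π k).toFinset) c) :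
    ∃ j < n, k ≤ j ∧ blockStart p π j = j ∧ rowAt π j ∈ c ∧ rowAt π j ∈ Y := by
  obtain ⟨a, ha⟩ := List.exists_mem_of_ne_nil c h.1
  rw [← rowAt_symm π a] at ha
  have hm := h.rowAt_blockStart_mem p π (Fin.is_lt _) ha
  have hlt := (blockStart_le p π (π.symm a)).trans_lt (Fin.is_lt _)
  have hA := h.2.2.1 _ hm
  rw [Finset.mem_sdiff, List.mem_toFinset, rowAt_mem_firstRows π hlt hk, not_lt] at hA
  exact ⟨_, hlt, hA.2, congrArg Prod.fst (phase_blockStart p π _), hm, hA.1⟩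

/-- The block ending at position `j`, without its first row. -/
def blockTail (j : ℕ) : List (Fin n) :=
  (List.range' (blockStart p π j + 1) (j - blockStart p π j)).map (rowAt π)

theorem cons_blockTail (j : ℕ) : rowAt π (blockStart p π j) :: blockTail p π j =
    (List.range' (blockStart p π j) (j + 1 - blockStart p π j)).map (rowAt π) := by
  have := blockStart_le p π j
  rw [Nat.sub_add_comm this, List.range'_succ, List.map_cons, blockTail]

theorem firstRows_append_block (j : ℕ) :
    firstRows π (blockStart p π j) ++ rowAt π (blockStart p π j) :: blockTail p π j =
      firstRows π (j + 1) := by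
  have := blockStart_le p π j
  rw [cons_blockTail, firstRows, firstRows, ← List.map_append, List.range_eq_range',
    List.range_eq_range']
  congr 1
  have h := List.range'_append_1 (s := 0) (m := blockStart p π j) (n := j + 1 - blockStart p π j)
  rw [Nat.zero_add] at h
  rw [h]
  congr 1
  omega

theorem isLedCycleIn_block {j : ℕ} (hj : j < n)
    (hend : j + 1 < n → blockStart p π (j + 1) = j + 1) :
    IsLedCycleIn (hashAlloc p π) (shuffling p π) (oldRows p π j)
      (curRows p π j \ (firstRows π (blockStart p π j)).toFinset)
      (rowAt π (blockStart p π j)) (blockTail p π j) := by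
  have hle := blockStart_le p π j
  refine ⟨?_, rowAt_blockStart_notMem p π j, ?_⟩
  · rw [cons_blockTail]
    refine ⟨?_, ?_, ?_, ?_⟩
    · simp; omega
    · refine List.Nodup.map_on ?_ List.nodup_range'
      intro x hx y hy h
      rw [List.mem_range'_1] at hx hy
      exact (rowAt_inj π (by omega) (by omega)).1 h
    · intro a ha
      obtain ⟨l, hl, rfl⟩ := List.mem_map.1 ha
      rw [List.mem_range'_1] at hl
      rw [Finset.mem_sdiff, List.mem_toFinset, rowAt_mem_firstRows π (by omega) (by omega)]
      refine ⟨?_, by omega⟩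
      rw [curRows, ← phase_eq_of_blockStart_le p π hl.1 (by omega)]
      exact rowAt_mem_curRows p π (by omega)
    · intro l hl
      have hl' : l < j + 1 - blockStart p π j := by simpa using hl
      simp only [List.get_eq_getElem, List.getElem_map, List.getElem_range', List.length_map,
        List.length_range', Nat.one_mul]
      rw [shuffling_rowAt p π (by omega)]
      congr 2
      have hb : blockStart p π (blockStart p π j + l) = blockStart p π j :=
        congrArg Prod.fst (phase_eq_of_blockStart_le p π (by omega) (by omega))
      rcases Nat.lt_or_ge (l + 1) (j + 1 - blockStart p π j) with h | h
      · have hb' : blockStart p π (blockStart p π j + l + 1) = blockStart p π j :=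
          congrArg Prod.fst (phase_eq_of_blockStart_le p π (by omega) (by omega))
        rw [Nat.mod_eq_of_lt h, nextPos, if_pos ⟨by omega, hb'.trans hb.symm⟩, Nat.add_assoc]
      -- The last row of the block is followed by its leader.
      · have h1 : l + 1 = j + 1 - blockStart p π j := by omega
        have h2 : blockStart p π j + l = j := by omega
        rw [h1, Nat.mod_self, h2, nextPos, if_neg, Nat.add_zero]
        rintro ⟨h3, h4⟩
        have := hend h3
        omega
  · intro b hb hX
    obtain ⟨l, hl, rfl⟩ := List.mem_map.1 hb
    rw [List.mem_range'_1] at hl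
    have hph : phase p π l = phase p π j := phase_eq_of_blockStart_le p π (by omega) (by omega)
    rw [oldRows, ← hph] at hX
    rw [blockStart, ← hph]
    exact rowAt_le_blockStart p π hX

/-- A competing cycle contains the first row of the current or a later block. If `X` and `Y` are
still the same there, that row is outside `X` and not below the current leader; after a renewal, it
would lie outside the current `Y`. -/
theorem inverseState_succ {j : ℕ} (hj : j < n)
    (hend : j + 1 < n → blockStart p π (j + 1) = j + 1)
    (h : InverseState p (hashAlloc p π) (shuffling p π) (firstRows π (blockStart p π j))
      (oldRows p π j) (curRows p π j)) :
    InverseState p (hashAlloc p π) (shuffling p π) (firstRows π (j + 1))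
      (oldRows p π j) (curRows p π j) := by
  rw [← firstRows_append_block p π j]
  refine .record _ _ _ _ _ h (isLedCycleIn_block p π hj hend) fun a c hac => ?_
  have hle := blockStart_le p π j
  obtain ⟨k, hk, hjk, hb, hc, hY⟩ := hac.1.exists_blockStart p π (hle.trans hj.le)
  have hph := phase_blockStart p π j
  have hX : rowAt π k ∉ oldRows p π k := by
    have := rowAt_blockStart_notMem p π k
    rwa [hb] at this
  rcases phase_le p π hjk with ⟨h1, _, h3⟩ | h1
  · rw [oldRows, oldRows, hph] at h1
    rw [hb, show blockStart p π (blockStart p π j) = _ from congrArg Prod.fst hph] at h3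
    rw [oldRows, h1] at hX
    rcases List.mem_cons.1 hc with he | hc
    · rwa [← he]
    · exact h3.trans (hac.2.2 _ hc hX)
  · rw [curRows, hph] at h1
    exact absurd (h1 hY) hX

theorem inverseState_blockStart {j : ℕ} (hj : j < n) :
    InverseState p (hashAlloc p π) (shuffling p π) (firstRows π (blockStart p π j))
      (oldRows p π j) (curRows p π j) := by
  induction j with
  | zero => exact .start
  | succ j ih =>
    have ih := ih (by omega)
    rcases phase_succ_cases p π j with ⟨h, hs⟩ | ⟨_, _, hs⟩ | ⟨_, _, hs⟩
    · have hb : blockStart p π (j + 1) = j + 1 := congrArg Prod.fst hs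
      have h1 := InverseState.renew _ _ _ (inverseState_succ p π (by omega) (fun _ => hb) ih)
        (by simpa [firstRows] using hj) (by
          -- A remaining cycle would contain the first row of a later block, which avoids its own
          -- `X` and hence the current `Y`.
          intro c hc
          obtain ⟨k, hk, hjk, hbk, -, hY⟩ := hc.exists_blockStart p π hj.le
          have hX := rowAt_blockStart_notMem p π k
          rw [hbk] at hX
          have hsub : curRows p π j ⊆ oldRows p π k := by
            have h2 : oldRows p π (j + 1) = curRows p π j := by rw [oldRows, hs]
            rcases phase_le p π hjk with h3 | h3
            · rw [h3.1, h2]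
            · rw [← h2]
              exact (oldRows_subset_curRows p π _).trans h3
          exact hX (hsub hY))
      rw [image_firstRows p π hj hb] at h1
      rw [hb, oldRows, curRows, hs]
      exact h1
    · have hb : blockStart p π (j + 1) = j + 1 := congrArg Prod.fst hs
      have h1 := inverseState_succ p π (by omega) (fun _ => hb) ih
      rw [hb, oldRows, curRows, hs]
      exact h1
    · rw [blockStart, oldRows, curRows, hs]
      exact ih

theorem exists_inverseState_ofFn :
    ∃ X Y, InverseState p (hashAlloc p π) (shuffling p π) (List.ofFn π) X Y := by
  obtain ⟨j, hjn⟩ := exists_succ_eq_size n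
  have h := inverseState_succ p π (j := j) (by omega) (fun h => absurd h (by omega))
    (inverseState_blockStart p π (by omega))
  rw [hjn, firstRows_self] at h
  exact ⟨_, _, h⟩

/-- By consistency the stable allocation circles the goods of `hashAlloc p π`, so determinism
applies. -/
theorem inverseConstruction_shuffling_iff (π' : Equiv.Perm (Fin n)) :
    InverseConstruction p (shuffling p π) π' ↔ π = π' := by
  have hcons := consistent_shuffling p π
  obtain ⟨X, Y, hX⟩ := exists_inverseState_ofFn p π
  constructor
  · rintro ⟨g', hg', X', Y', h⟩
    have hg : (fun k => g' (shuffling p π k)) = hashAlloc p π := funext ((hcons g').1 hg')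
    rw [hg] at h
    exact hX.ofFn_unique (hashAlloc_injective p π) h
  · rintro rfl
    have hg : (fun k => hashAlloc p π ((shuffling p π).symm (shuffling p π k))) =
        hashAlloc p π := funext fun k => by rw [Equiv.symm_apply_apply]
    refine ⟨fun t => hashAlloc p π ((shuffling p π).symm t), (hcons _).2 (congrFun hg), X, Y, ?_⟩
    rw [hg]
    exact hX

theorem shuffling_injective : Function.Injective (shuffling p) := fun π π' h =>
  (inverseConstruction_shuffling_iff p π π').1
    (h ▸ (inverseConstruction_shuffling_iff p π' π').2 rfl)

end Inverse

theorem mainTheorem2 (n : ℕ) (p : Prefs n) :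
    ∃ e : Equiv.Perm (Fin n) ≃ Equiv.Perm (Fin n),
      (∀ π, Consistent p π (e π)) ∧
      (∀ π σ, ForwardConstruction p π σ ↔ e π = σ) ∧
      (∀ σ π, InverseConstruction p σ π ↔ e.symm σ = π) := by
  rcases Nat.eq_zero_or_pos n with rfl | hn
  -- The empty case is separate, since `rowAt` needs a nonempty index type.
  · have hst : ∀ (q : Prefs 0) g, IsStable q g := fun q g =>
      ⟨⟨fun i => i.elim0, fun i => i.elim0⟩, fun C hC => hC.choose.elim0⟩
    refine ⟨Equiv.refl _, fun π g' => iff_of_true (hst _ _) fun k => k.elim0,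
      fun π σ => iff_of_true ⟨∅, circledFirst p (hashAlloc p π) ∅, ?_⟩ (Subsingleton.elim _ _),
      fun σ π => iff_of_true ⟨id, hst _ _, ∅, circledFirst p (fun k => id (σ k)) ∅, ?_⟩ (Subsingleton.elim _ _)⟩
    · rw [Subsingleton.elim (fun i => some (σ i)) fun _ => none]
      exact .start
    · rw [List.ofFn_zero]
      exact .start
  · have : NeZero n := ⟨hn.ne'⟩
    refine ⟨Equiv.ofBijective (shuffling p)
      (Finite.injective_iff_bijective.1 (shuffling_injective p)),
      consistent_shuffling p, forwardConstruction_iff p, fun σ π => ?_⟩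
    set e := Equiv.ofBijective (shuffling p)
      (Finite.injective_iff_bijective.1 (shuffling_injective p)) with he
    have hσ : σ = shuffling p (e.symm σ) := (e.apply_symm_apply σ).symm
    conv_lhs => rw [hσ]
    exact inverseConstruction_shuffling_iff p _ π
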